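/- Let $d\ge 1$, let $\Omega\subset\mathbb R^d$ be a bounded connected open set, $T>0$, and let $(\phi_j)_{j\ge1}$ be an orthonormal basis of $L^2(\Omega)$ consisting of (weak, $H^1_0$) eigenfunctions of the Dirichlet Laplacian, $-\Delta\phi_j=\lambda_j\phi_j$, with $\lambda_1\le\lambda_2\le\dots$. For $q\ge 0$ put $\|v\|_{H^q}^2=\sum_{j}\lambda_j^{q}\langle v,\phi_j\rangle^2$. Let $F:\Omega\times(0,T)\times\mathbb R\to\mathbb R$ satisfy $|F(x,t,a)-F(x,t,b)|\le k|a-b|$ for all $x,t,a,b$, with a constant $k\ge0$. Let $\gamma\ge0$, $g\in H^{2\gamma}$, and let $u\in C([0,T];L^2(\Omega))\cap L^2(0,T;H^1_0(\Omega))$ be a weak solution of $$u_t-\Delta u=F(x,t,u)\ \text{in }\Omega\times(0,T),\qquad u|_{\partial\Omega}=0,\qquad u(\cdot,T)=g,$$ with $F(\cdot,\cdot,u)\in L^1(0,T;L^2(\Omega))$, such that for some $r>0$ and $A''$ $$\sum_{j\ge1}e^{2(t+r)\lambda_j}\langle u(\cdot,t),\phi_j\rangle^2<A''\qquad\text{for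 all }t\in[0,T].$$ Let $\xi$ be a Gaussian white noise on $L^2(\Omega)$, that is, a bounded linear map $\chi\mapsto\langle\xi,\chi\rangle$ from $L^2(\Omega)$ to $L^2$ of a probability space with $\langle\xi,\chi\rangle\sim\mathcal N(0,\|\chi\|^2)$ and $\mathbf E\langle\xi,\chi_1\rangle\langle\xi,\chi_2\rangle=\langle\chi_1,\chi_2\rangle$. For $\delta>0$ let $N(\delta)\ge1$ be an integer, $\alpha(\delta)\in\mathbb R$, and $$\overline G_\delta=\sum_{j=1}^{N(\delta)}\big(\langle g,\phi_j\rangle+\delta\langle\xi,\phi_j\rangle\big)\phi_j,\qquad J_{\alpha}v=\sum_{\lambda_j\le\alpha}\langle v,\phi_j\rangle\phi_j .$$ Let the random function $u^\delta$ be, almost surely, the weak solution (in the same class) of $$u^\delta_t-\Delta u^\delta=J_{\alpha(\delta)}F(x,t,u^\delta)\ \text{in }\Omega\times(0,T),\qquad u^\delta|_{\partial\Omega}=0,\qquad u^\delta(\cdot,T)=J_{\alpha(\delta)}\overline G_\delta .$$ Assume that, as $\delta\to0^+$, $$\alpha(\delta)\to+\infty,\qquad \frac{e^{kT\alpha(\delta)}}{\lambda_{N(\delta)}^{\gamma}}\to0,\qquad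 e^{kT\alpha(\delta)}\sqrt{N(\delta)}\,\delta\to0 .$$ Then for every $p\ge0$ and all sufficiently small $\delta>0$, for all $t\in[0,T]$, with $N=N(\delta)$ and $\alpha=\alpha(\delta)$, $$\mathbf E\|u^\delta(\cdot,t)-u(\cdot,t)\|_{H^p}^2\le 2e^{2k^2T(T-t)}e^{-2t\alpha}|\alpha|^p\Big[2\delta^2Ne^{2T\alpha}+2\frac{e^{2T\alpha}}{\lambda_N^{2\gamma}}\|g\|_{H^{2\gamma}}^2+A''e^{-2r\alpha}\Big]+A''|\alpha|^pe^{-2(t+r)\alpha}.$$ -/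

import Mathlib

open MeasureTheory ProbabilityTheory Set Filter Topology
open scoped ENNReal NNReal InnerProductSpace Gradient

noncomputable section

namespace BackwardHeat

/-- The Euclidean space `ℝ^d`. -/
abbrev Eucl (d : ℕ) : Type := EuclideanSpace ℝ (Fin d)

/-- The real Hilbert space `L²(Ω)` (Lebesgue measure). -/
abbrev L2 {d : ℕ} (Ω : Set (Eucl d)) : Type := Lp ℝ 2 (volume.restrict Ω)

/-- The Hilbert space `L²(Ω; ℝ^d)` of square integrable vector fields. -/
abbrev L2vec {d : ℕ} (Ω : Set (Eucl d)) : Type := Lp (Eucl d) 2 (volume.restrict Ω)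

/-- The graph of the gradient on `C_c^∞(Ω)`, in `L²(Ω) × L²(Ω; ℝ^d)`. -/
def testGraph {d : ℕ} (Ω : Set (Eucl d)) : Set (L2 Ω × L2vec Ω) :=
  {q | ∃ η : Eucl d → ℝ, ContDiff ℝ ((⊤ : ℕ∞) : WithTop ℕ∞) η ∧ HasCompactSupport η ∧ tsupport η ⊆ Ω ∧
    q.1 =ᵐ[volume.restrict Ω] η ∧ q.2 =ᵐ[volume.restrict Ω] fun x => ∇ η x}

/-- The graph of the weak gradient on `H¹₀(Ω)`: since `H¹₀(Ω)` is the closure of `C_c^∞(Ω)` in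
`H¹(Ω)`, a pair `(v, V)` lies in this set iff `v ∈ H¹₀(Ω)` and `V = ∇v`. -/
def H10Graph {d : ℕ} (Ω : Set (Eucl d)) : Set (L2 Ω × L2vec Ω) := closure (testGraph Ω)

/-- `v` solves `-Δv = l v` in `Ω`, `v = 0` on `∂Ω`, in the weak sense. -/
def IsDirichletEigenfunction {d : ℕ} (Ω : Set (Eucl d)) (l : ℝ) (v : L2 Ω) : Prop :=
  ∃ V : L2vec Ω, (v, V) ∈ H10Graph Ω ∧
    ∀ w W, (w, W) ∈ H10Graph Ω → ⟪V, W⟫_ℝ = l * ⟪v, w⟫_ℝ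

/-- `φ₁, φ₂, …` is an orthonormal basis of `L²(Ω)` made of eigenfunctions of the Dirichlet
Laplacian, with eigenvalues `λ₁ ≤ λ₂ ≤ …`. -/
structure IsDirichletEigenbasis {d : ℕ} (Ω : Set (Eucl d)) (lam : ℕ+ → ℝ)
    (φ : HilbertBasis ℕ+ ℝ (L2 Ω)) : Prop where
  monotone : Monotone lam
  eigen : ∀ j, IsDirichletEigenfunction Ω (lam j) (φ j)

/-- `‖v‖²_{H^p} = ∑_j λ_j^p ⟨v, φ_j⟩²`, with the value `∞` where the series diverges. -/
def hpNormSq {d : ℕ} {Ω : Set (Eucl d)} (lam : ℕ+ → ℝ) (φ : HilbertBasis ℕ+ ℝ (L2 Ω))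
    (p : ℝ) (v : L2 Ω) : ℝ≥0∞ :=
  ∑' j, ENNReal.ofReal (lam j ^ p * ⟪v, φ j⟫_ℝ ^ 2)

/-- The truncation operator `J_a v = ∑_{λ_j ≤ a} ⟨v, φ_j⟩ φ_j`. -/
def trunc {d : ℕ} {Ω : Set (Eucl d)} (lam : ℕ+ → ℝ) (φ : HilbertBasis ℕ+ ℝ (L2 Ω))
    (a : ℝ) (v : L2 Ω) : L2 Ω :=
  ∑' j, if lam j ≤ a then ⟪v, φ j⟫_ℝ • φ j else 0

/-- `u` is a weak solution of `u_t - Δu = f` in `Ω × (0,T)`, `u = 0` on `∂Ω`, `u(T) = g`: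
`u ∈ C([0,T]; L²(Ω)) ∩ L²(0,T; H¹₀(Ω))`, `U = ∇u`, and the equation holds tested against every
`w ∈ H¹₀(Ω)` and integrated in time over `[t,T]`. -/
structure IsHeatSolution {d : ℕ} (Ω : Set (Eucl d)) (T : ℝ) (f : ℝ → L2 Ω) (g : L2 Ω)
    (u : ℝ → L2 Ω) : Prop where
  continuousOn : ContinuousOn u (Icc 0 T)
  final : u T = g
  weak : ∃ U : ℝ → L2vec Ω, MemLp U 2 (volume.restrict (Ioo 0 T)) ∧
    (∀ᵐ s ∂(volume.restrict (Ioo 0 T)), (u s, U s) ∈ H10Graph Ω) ∧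
    ∀ w W, (w, W) ∈ H10Graph Ω → ∀ t ∈ Icc 0 T,
      ⟪u T, w⟫_ℝ - ⟪u t, w⟫_ℝ + ∫ s in t..T, ⟪U s, W⟫_ℝ = ∫ s in t..T, ⟪f s, w⟫_ℝ

/-- `f ∈ L¹(0,T; L²(Ω))` is the source `f(x,s) = F(x, s, u(x,s))`. -/
structure IsSource {d : ℕ} (Ω : Set (Eucl d)) (T : ℝ) (F : Eucl d → ℝ → ℝ → ℝ)
    (u f : ℝ → L2 Ω) : Prop where
  integrable : IntegrableOn f (Ioo 0 T) volume
  ae_eq : ∀ᵐ s ∂(volume.restrict (Ioo 0 T)),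
    f s =ᵐ[volume.restrict Ω] fun x => F x s (u s x)

/-- `u` solves `u_t - Δu = F(x,t,u)` in `Ω × (0,T)`, `u = 0` on `∂Ω`, `u(T) = g`. -/
def IsSolution {d : ℕ} (Ω : Set (Eucl d)) (T : ℝ) (F : Eucl d → ℝ → ℝ → ℝ) (g : L2 Ω)
    (u : ℝ → L2 Ω) : Prop :=
  ∃ f, IsSource Ω T F u f ∧ IsHeatSolution Ω T f g u

/-- `u` solves the truncated problem `u_t - Δu = J_a F(x,t,u)` in `Ω × (0,T)`, `u = 0` on `∂Ω`,
`u(T) = J_a G`. -/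
def IsTruncatedSolution {d : ℕ} {Ω : Set (Eucl d)} (lam : ℕ+ → ℝ)
    (φ : HilbertBasis ℕ+ ℝ (L2 Ω)) (a T : ℝ) (F : Eucl d → ℝ → ℝ → ℝ) (G : L2 Ω)
    (u : ℝ → L2 Ω) : Prop :=
  ∃ f, IsSource Ω T F u f ∧
    IsHeatSolution Ω T (fun s => trunc lam φ a (f s)) (trunc lam φ a G) u

/-- Gaussian white noise on a real Hilbert space `H`: a bounded linear map `H → L²(P)` with
`⟨ξ, χ⟩ ∼ N(0, ‖χ‖²)` and `E(⟨ξ, χ₁⟩⟨ξ, χ₂⟩) = ⟨χ₁, χ₂⟩`. -/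
structure IsGaussianWhiteNoise {S : Type*} [MeasurableSpace S] (P : Measure S) {H : Type*}
    [NormedAddCommGroup H] [InnerProductSpace ℝ H] (ξ : H →L[ℝ] Lp ℝ 2 P) : Prop where
  law : ∀ χ, HasLaw (ξ χ) (gaussianReal 0 (‖χ‖₊ ^ 2)) P
  covariance : ∀ χ₁ χ₂, ∫ ω, ξ χ₁ ω * ξ χ₂ ω ∂P = ⟪χ₁, χ₂⟫_ℝ

/-- The observed final data `∑_{j ≤ N} (⟨g, φ_j⟩ + δ ⟨ξ, φ_j⟩) φ_j`. -/
def observed {d : ℕ} {Ω : Set (Eucl d)} {S : Type*} [MeasurableSpace S] {P : Measure S}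
    (φ : HilbertBasis ℕ+ ℝ (L2 Ω)) (ξ : L2 Ω →L[ℝ] Lp ℝ 2 P) (g : L2 Ω) (δ : ℝ) (N : ℕ+)
    (ω : S) : L2 Ω :=
  ∑ j ∈ Finset.Icc 1 N, (⟪g, φ j⟫_ℝ + δ * ξ (φ j) ω) • φ j

end BackwardHeat

end

open BackwardHeat

/-! Tested against an eigenfunction, the weak equation becomes a scalar integral equation, solved by
variation of constants (`IsHeatSolution.exp_mul_inner`). For a mode with `lam j ≤ a`, the truncated
and exact equations have the same form, and backward amplification is at most that of frequency `a`.
For `lam j > a` the approximation vanishes, so the error is the coefficient of `u`, controlled by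
the exponentially weighted bound on `u`.

Squaring, summing by Parseval and using the Lipschitz bound gives an integral inequality for the
squared `L²` error weighted by `exp (2 * a * t)`; Grönwall closes it (`norm_sub_sq_le`). This
pathwise estimate depends on the noise only through the squared error of the final data, whose mean
is at most a variance `δ² N` plus a spectral tail (`lintegral_norm_observed_sub_sq_le`). The `H^p`
norm costs a factor `a ^ p` below the cut-off, while above it the exponential weight on `u` absorbs
the power (`hpNormSq_sub_le`). -/

namespace BackwardHeat

/-! ### Calculus on a time interval. -/

/-- Variation of constants for `-y' + l y = h` backward in time, in integrated form. -/
lemma variation_of_constants {t T l : ℝ} (htT : t ≤ T) {y h : ℝ → ℝ}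
    (hy : IntervalIntegrable y volume t T) (hh : IntervalIntegrable h volume t T)
    (heq : ∀ τ ∈ Icc t T, y T - y τ + ∫ s in τ..T, l * y s = ∫ s in τ..T, h s) :
    Real.exp (l * t) * y t =
      Real.exp (l * T) * y T - ∫ s in t..T, Real.exp (l * s) * h s := by
  set q : ℝ → ℝ := fun s => h s - l * y s with hq
  have hly : IntervalIntegrable (fun s => l * y s) volume t T := hy.const_mul l
  have hqi : IntervalIntegrable q volume t T := hh.sub hly
  -- The source is only integrable, so `y` need not be differentiable everywhere. It agrees on
  -- `[t,T]` with `y T + Q`, which is absolutely continuous, and that suffices for integration by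
  -- parts.
  set Q : ℝ → ℝ := fun x => ∫ s in T..x, q s with hQ
  have hsub : ∀ τ ∈ Icc t T, uIcc τ T ⊆ uIcc t T := fun τ hτ => by
    rw [uIcc_of_le hτ.2, uIcc_of_le htT]; exact Icc_subset_Icc_left hτ.1
  have hYy : ∀ τ ∈ Icc t T, y T + Q τ = y τ := fun τ hτ => by
    have h1 := heq τ hτ
    have h2 : ∫ s in τ..T, q s = (∫ s in τ..T, h s) - ∫ s in τ..T, l * y s :=
      intervalIntegral.integral_sub (hh.mono_set (hsub τ hτ)) (hly.mono_set (hsub τ hτ))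
    rw [hQ]
    dsimp only
    rw [intervalIntegral.integral_symm, h2]
    linarith
  have hE : ContDiff ℝ 1 (fun x : ℝ => Real.exp (l * x)) := by fun_prop
  have hQac : AbsolutelyContinuousOnInterval Q t T :=
    hqi.absolutelyContinuousOnInterval_intervalIntegral right_mem_uIcc
  have hcac : AbsolutelyContinuousOnInterval (fun _ : ℝ => y T) t T :=
    (contDiff_const (n := 1)).contDiffOn.absolutelyContinuousOnInterval
  have key := AbsolutelyContinuousOnInterval.integral_deriv_mul_eq_sub
    (hE.contDiffOn (s := uIcc t T)).absolutelyContinuousOnInterval (hcac.add hQac)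
  have hint : ∫ s in t..T, Real.exp (l * s) * h s =
      ∫ x in t..T, deriv (fun x : ℝ => Real.exp (l * x)) x * ((fun _ : ℝ => y T) + Q) x
        + Real.exp (l * x) * deriv ((fun _ : ℝ => y T) + Q) x := by
    apply intervalIntegral.integral_congr_ae
    filter_upwards [hqi.ae_hasDerivAt_integral] with x hx hxm
    have hxm' := uIoc_subset_uIcc hxm
    have hd : HasDerivAt ((fun _ : ℝ => y T) + Q) (q x) x := by
      have := (hasDerivAt_const x (y T)).add (hx hxm' T right_mem_uIcc)
      simpa using this
    have he : HasDerivAt (fun x : ℝ => Real.exp (l * x)) (Real.exp (l * x) * l) x := by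
      have := ((hasDerivAt_id x).const_mul l).exp
      simpa using this
    rw [hd.deriv, he.deriv]
    rw [uIcc_of_le htT] at hxm'
    have := hYy x hxm'
    simp only [Pi.add_apply, this, hq]
    ring
  rw [hint, key]
  have h1 := hYy t (left_mem_Icc.2 htT)
  have h2 := hYy T (right_mem_Icc.2 htT)
  simp only [Pi.add_apply, h1, h2]
  ring

/-- Grönwall's inequality in integral form, backward in time. -/
lemma gronwall_backward {T C K : ℝ} {Z : ℝ → ℝ} (hZ : ContinuousOn Z (Icc 0 T)) (hK : 0 ≤ K)
    (h : ∀ t ∈ Icc 0 T, Z t ≤ C + K * ∫ s in t..T, Z s) {t : ℝ} (ht : t ∈ Icc 0 T) :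
    Z t ≤ C * Real.exp (K * (T - t)) := by
  have h0T : 0 ≤ T := ht.1.trans ht.2
  -- Extending `Z` continuously to the whole line gives the integral a two-sided derivative at every
  -- point, endpoints included.
  set Z' : ℝ → ℝ := IccExtend h0T ((Icc 0 T).domRestrict Z) with hZ'
  have hc : Continuous Z' := (continuousOn_iff_continuous_domRestrict.1 hZ).Icc_extend'
  have heq : ∀ s ∈ Icc 0 T, Z' s = Z s := fun s hs => by
    rw [hZ', IccExtend_of_mem _ _ hs]; rfl
  -- The integrating factor times the majorant of `Z`. Its derivative is nonnegative exactly because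
  -- `Z` lies below that majorant, and `Q T = exp (K * T) * C`.
  set Q : ℝ → ℝ := fun τ => Real.exp (K * τ) * (C + K * ∫ s in τ..T, Z' s) with hQ
  have hd : ∀ τ, HasDerivAt Q (Real.exp (K * τ) * K * (C + K * ∫ s in τ..T, Z' s)
      + Real.exp (K * τ) * (K * (-Z' τ))) τ := fun τ => by
    have h1 : HasDerivAt (fun τ => ∫ s in τ..T, Z' s) (-Z' τ) τ :=
      intervalIntegral.integral_hasDerivAt_left (hc.intervalIntegrable _ _)
        hc.aestronglyMeasurable.stronglyMeasurableAtFilter hc.continuousAt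
    have h2 : HasDerivAt (fun x : ℝ => Real.exp (K * x)) (Real.exp (K * τ) * K) τ := by
      have := ((hasDerivAt_id τ).const_mul K).exp
      simpa using this
    exact h2.mul ((h1.const_mul K).const_add C)
  have hint : ∀ τ ∈ Icc 0 T, ∫ s in τ..T, Z' s = ∫ s in τ..T, Z s := fun τ hτ => by
    apply intervalIntegral.integral_congr
    intro s hs
    rw [uIcc_of_le hτ.2] at hs
    exact heq s ⟨hτ.1.trans hs.1, hs.2⟩
  have hm : MonotoneOn Q (Icc 0 T) := by
    apply monotoneOn_of_deriv_nonneg (convex_Icc 0 T)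
      (fun τ _ => (hd τ).continuousAt.continuousWithinAt)
      (fun τ _ => (hd τ).differentiableAt.differentiableWithinAt)
    intro τ hτ
    have hτ := interior_subset hτ
    rw [(hd τ).deriv, hint τ hτ, heq τ hτ]
    have := h τ hτ
    have h3 : 0 ≤ Real.exp (K * τ) * K * ((C + K * ∫ s in τ..T, Z s) - Z τ) :=
      mul_nonneg (by positivity) (by linarith)
    linarith
  have h4 := hm ht (right_mem_Icc.2 h0T) ht.2
  simp only [hQ, intervalIntegral.integral_same, mul_zero, add_zero, hint t ht] at h4
  have h5 : C * Real.exp (K * (T - t)) = Real.exp (-(K * t)) * (Real.exp (K * T) * C) := by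
    rw [← mul_assoc, ← Real.exp_add, mul_comm C]; congr 2; ring
  have h6 : Z t ≤ Real.exp (-(K * t)) * (Real.exp (K * t) * (C + K * ∫ s in t..T, Z s)) := by
    rw [← mul_assoc, ← Real.exp_add]; simpa using h t ht
  rw [h5]
  exact h6.trans (mul_le_mul_of_nonneg_left h4 (Real.exp_nonneg _))

/-- The Cauchy–Schwarz inequality against the constant function on an interval. -/
lemma sq_intervalIntegral_le {t T : ℝ} (htT : t ≤ T) {f : ℝ → ℝ}
    (hf : IntervalIntegrable f volume t T)
    (hf2 : IntervalIntegrable (fun s => f s ^ 2) volume t T) :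
    (∫ s in t..T, f s) ^ 2 ≤ (T - t) * ∫ s in t..T, f s ^ 2 := by
  rcases htT.eq_or_lt with rfl | hlt
  · simp
  set I := ∫ s in t..T, f s with hI
  have hpos : 0 < T - t := sub_pos.2 hlt
  -- Variance argument: expanding the square of the deviation from the mean, scaled by `T - t`,
  -- gives the inequality.
  have h0 : 0 ≤ ∫ s in t..T, ((T - t) * f s - I) ^ 2 :=
    intervalIntegral.integral_nonneg htT fun s _ => sq_nonneg _
  have h1 : ∫ s in t..T, ((T - t) * f s - I) ^ 2 =
      (T - t) ^ 2 * (∫ s in t..T, f s ^ 2) - 2 * (T - t) * I * I + I ^ 2 * (T - t) := by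
    have : (fun s => ((T - t) * f s - I) ^ 2) =
        fun s => (T - t) ^ 2 * f s ^ 2 - 2 * (T - t) * I * f s + I ^ 2 := by
      funext s; ring
    rw [this, intervalIntegral.integral_add ((hf2.const_mul _).sub (hf.const_mul _))
      intervalIntegrable_const, intervalIntegral.integral_sub (hf2.const_mul _) (hf.const_mul _),
      intervalIntegral.integral_const_mul, intervalIntegral.integral_const_mul,
      intervalIntegral.integral_const, smul_eq_mul, ← hI]
    ring
  rw [h1] at h0
  have h2 : 0 ≤ (T - t) * ((T - t) * (∫ s in t..T, f s ^ 2) - I ^ 2) := by nlinarith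
  linarith [nonneg_of_mul_nonneg_right h2 hpos]

/-! ### Poincaré inequality and positivity of the spectrum. -/

lemma norm_sq_eq_integral {d : ℕ} {Ω : Set (Eucl d)} {E : Type*} [NormedAddCommGroup E]
    [InnerProductSpace ℝ E] (v : Lp E 2 (volume.restrict Ω)) :
    ‖v‖ ^ 2 = ∫ x in Ω, ‖v x‖ ^ 2 := by
  rw [← real_inner_self_eq_norm_sq, L2.inner_def]
  simp only [real_inner_self_eq_norm_sq]

/-- The Poincaré inequality on `H¹₀(Ω)` for a bounded domain. -/
lemma poincare {d : ℕ} (hd : 1 ≤ d) {Ω : Set (Eucl d)} {R : ℝ} (hR : ∀ x ∈ Ω, ‖x‖ ≤ R)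
    {v : L2 Ω} {V : L2vec Ω} (h : (v, V) ∈ H10Graph Ω) :
    ‖v‖ ^ 2 ≤ 4 * R ^ 2 * ‖V‖ ^ 2 := by
  have hcl : IsClosed {q : L2 Ω × L2vec Ω | ‖q.1‖ ^ 2 ≤ 4 * R ^ 2 * ‖q.2‖ ^ 2} :=
    isClosed_le (by fun_prop) (by fun_prop)
  -- The inequality is a closed condition on the pair, so test functions suffice.
  suffices hsub : testGraph Ω ⊆ {q : L2 Ω × L2vec Ω | ‖q.1‖ ^ 2 ≤ 4 * R ^ 2 * ‖q.2‖ ^ 2} by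
    have hsub' := closure_minimal hsub hcl
    rw [H10Graph] at h
    have h' := hsub' h
    simpa only [mem_ofPred_eq] using h'
  rintro ⟨v, V⟩ ⟨η, hη, hηc, hηs, hv, hV⟩
  dsimp only at hv hV ⊢
  let i : Fin d := ⟨0, hd⟩
  set e : Eucl d := EuclideanSpace.single i 1 with he
  have hη1 : ContDiff ℝ 1 η := hη.of_le (by exact_mod_cast le_top)
  have hηd : Differentiable ℝ η := hη1.differentiable one_ne_zero
  have hfd : Continuous (fderiv ℝ η) := hη1.continuous_fderiv one_ne_zero
  have hgr : ∀ x, fderiv ℝ η x e = ⟪∇ η x, e⟫_ℝ := fun x => by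
    rw [gradient, InnerProductSpace.toDual_symm_apply]
  have hgc : Continuous (∇ η) := by
    unfold gradient; fun_prop
  have hzero : ∀ x, x ∉ Ω → η x = 0 := fun x hx => image_eq_zero_of_notMem_tsupport
    fun h' => hx (hηs h')
  have hfzero : ∀ x, x ∉ tsupport η → fderiv ℝ η x = 0 := fun x hx => by
    by_contra h'
    exact hx (support_fderiv_subset ℝ h')
  have hgzero : ∀ x, x ∉ tsupport η → ∇ η x = 0 := fun x hx => by
    rw [gradient, hfzero x hx, map_zero]
  let x' : Eucl d →L[ℝ] ℝ := EuclideanSpace.proj i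
  have hx'e : x' e = 1 := by simp [x', he]
  have hx'n : ∀ x, |x' x| ≤ ‖x‖ := fun x => by
    simpa [x'] using PiLp.norm_apply_le x i
  have hen : ‖e‖ = 1 := by simp [he]
  have hd2 : ∀ x, fderiv ℝ (fun y => η y ^ 2) x e = 2 * η x * ⟪∇ η x, e⟫_ℝ := fun x => by
    have := ((hηd x).hasFDerivAt.pow 2).fderiv
    rw [← hgr, this]; simp
  have i1 : Integrable (fun x => η x ^ 2) :=
    (by fun_prop : Continuous fun x => η x ^ 2).integrable_of_hasCompactSupport
      (hηc.comp_left (g := fun z : ℝ => z ^ 2) (by simp))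
  have i2 : Integrable (fun x => x' x * (2 * η x * ⟪∇ η x, e⟫_ℝ)) :=
    (by fun_prop : Continuous _).integrable_of_hasCompactSupport
      (HasCompactSupport.intro hηc fun x hx => by simp [hgzero x hx])
  have i3 : Integrable (fun x => x' x * η x ^ 2) :=
    (by fun_prop : Continuous _).integrable_of_hasCompactSupport
      (HasCompactSupport.intro hηc fun x hx => by simp [image_eq_zero_of_notMem_tsupport hx])
  have i4 : Integrable (fun x => ‖∇ η x‖ ^ 2) :=
    (by fun_prop : Continuous _).integrable_of_hasCompactSupport
      (HasCompactSupport.intro hηc fun x hx => by simp [hgzero x hx])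
  -- The field `x' e` has divergence one, so `∫ η² = -∫ x' · 2 η ∂ₑη`.
  have parts := integral_mul_fderiv_eq_neg_fderiv_mul_of_integrable (μ := volume) (v := e)
    (f := x') (g := fun y => η y ^ 2)
    (by simpa [hx'e] using i1) (by simpa [hd2] using i2) i3
    (fun x _ => x'.differentiableAt) (fun x _ => (hηd x).pow 2)
  simp only [hd2, ContinuousLinearMap.fderiv, hx'e, one_mul] at parts
  -- Young's inequality from `(η + 2 x' ∂ₑη)² ≥ 0`. The right side integrates to zero by `parts`,
  -- hence the constant `4 R²`.
  have hpt : ∀ x, (1 / 2) * η x ^ 2 - 2 * R ^ 2 * ‖∇ η x‖ ^ 2 ≤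
      η x ^ 2 + x' x * (2 * η x * ⟪∇ η x, e⟫_ℝ) := fun x => by
    by_cases hx : x ∈ Ω
    · have h1 : |x' x| ≤ R := (hx'n x).trans (hR x hx)
      have h2 : |⟪∇ η x, e⟫_ℝ| ≤ ‖∇ η x‖ := by
        simpa [hen] using abs_real_inner_le_norm (∇ η x) e
      have h3 : (x' x * ⟪∇ η x, e⟫_ℝ) ^ 2 ≤ R ^ 2 * ‖∇ η x‖ ^ 2 := by
        have h4 := (abs_nonneg _).trans h1
        rw [← mul_pow, ← sq_abs, abs_mul]
        gcongr
      nlinarith [sq_nonneg (η x + 2 * (x' x * ⟪∇ η x, e⟫_ℝ))]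
    · have := hgzero x (fun h' => hx (hηs h'))
      simp [hzero x hx, this]
  have hmono := integral_mono ((i1.const_mul (1 / 2)).sub (i4.const_mul (2 * R ^ 2)))
    (i1.add i2) hpt
  have e1 := integral_add i1 i2
  have e2 := integral_sub (i1.const_mul (1 / 2)) (i4.const_mul (2 * R ^ 2))
  simp only [integral_const_mul] at e2
  have n1 : ‖v‖ ^ 2 = ∫ x, η x ^ 2 := by
    rw [norm_sq_eq_integral, ← setIntegral_eq_integral_of_forall_compl_eq_zero (s := Ω)
      (f := fun x => η x ^ 2)]
    · apply integral_congr_ae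
      filter_upwards [hv] with x hx
      simp [hx]
    · intro x hx; simp [hzero x hx]
  have n2 : ‖V‖ ^ 2 = ∫ x, ‖∇ η x‖ ^ 2 := by
    rw [norm_sq_eq_integral, ← setIntegral_eq_integral_of_forall_compl_eq_zero (s := Ω)
      (f := fun x => ‖∇ η x‖ ^ 2)]
    · apply integral_congr_ae
      filter_upwards [hV] with x hx
      simp [hx]
    · intro x hx; simp [hgzero x (fun h' => hx (hηs h'))]
  simp only [Pi.add_apply, Pi.sub_apply] at hmono
  rw [mem_ofPred_eq, n1, n2]
  linarith

/-- Dirichlet eigenvalues of a bounded domain are positive. -/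
lemma eigenvalue_pos {d : ℕ} (hd : 1 ≤ d) {Ω : Set (Eucl d)} (hΩb : Bornology.IsBounded Ω)
    {l : ℝ} {v : L2 Ω} (hv : IsDirichletEigenfunction Ω l v) (hv0 : v ≠ 0) : 0 < l := by
  obtain ⟨V, hV, h⟩ := hv
  obtain ⟨R, hR⟩ := hΩb.exists_norm_le
  have h1 := poincare hd hR hV
  have h2 := h v V hV
  rw [real_inner_self_eq_norm_sq, real_inner_self_eq_norm_sq] at h2
  have h3 : 0 < ‖v‖ ^ 2 := by positivity
  have h4 : 0 < ‖V‖ ^ 2 := by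
    by_contra h'
    have : ‖V‖ ^ 2 = 0 := le_antisymm (not_lt.1 h') (sq_nonneg _)
    rw [this] at h1
    linarith
  rw [h2] at h4
  exact pos_of_mul_pos_left h4 h3.le

end BackwardHeat

namespace BackwardHeat

/-! ### Fourier coefficients of solutions. -/

lemma intervalIntegrable_of_integrableOn_Ioo {T t : ℝ} {f : ℝ → ℝ}
    (hf : IntegrableOn f (Ioo 0 T)) (ht : t ∈ Icc 0 T) : IntervalIntegrable f volume t T := by
  rw [intervalIntegrable_iff_integrableOn_Ioo_of_le ht.2]
  exact hf.mono_set (Ioo_subset_Ioo_left ht.1)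

lemma ae_restrict_Icc_of_ae_restrict_Ioo {T t : ℝ} {p : ℝ → Prop} (ht : t ∈ Icc 0 T)
    (h : ∀ᵐ s ∂(volume.restrict (Ioo 0 T)), p s) : ∀ᵐ s ∂(volume.restrict (Icc t T)), p s := by
  rw [← Measure.restrict_congr_set (Ioo_ae_eq_Icc (a := t) (b := T))]
  exact ae_mono (Measure.restrict_mono (Ioo_subset_Ioo_left ht.1) le_rfl) h

section Hilbert

variable {d : ℕ} {Ω : Set (Eucl d)} (φ : HilbertBasis ℕ+ ℝ (L2 Ω))

lemma hasSum_inner_sq (v : L2 Ω) : HasSum (fun j => ⟪v, φ j⟫_ℝ ^ 2) (‖v‖ ^ 2) := by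
  have h := φ.hasSum_inner_mul_inner v v
  rw [real_inner_self_eq_norm_sq] at h
  refine h.congr_fun ?_
  intro j
  rw [real_inner_comm v (φ j), sq]

lemma tsum_ofReal_inner_sq (v : L2 Ω) :
    ∑' j, ENNReal.ofReal (⟪v, φ j⟫_ℝ ^ 2) = ENNReal.ofReal (‖v‖ ^ 2) := by
  rw [← (hasSum_inner_sq φ v).tsum_eq,
    ENNReal.ofReal_tsum_of_nonneg (fun j => sq_nonneg _) (hasSum_inner_sq φ v).summable]

lemma sum_inner_sq_le (v : L2 Ω) (s : Finset ℕ+) : ∑ j ∈ s, ⟪v, φ j⟫_ℝ ^ 2 ≤ ‖v‖ ^ 2 :=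
  sum_le_hasSum s (fun _ _ => sq_nonneg _) (hasSum_inner_sq φ v)

lemma inner_basis (i j : ℕ+) : ⟪φ i, φ j⟫_ℝ = if i = j then 1 else 0 :=
  orthonormal_iff_ite.1 φ.orthonormal i j

lemma inner_trunc (lam : ℕ+ → ℝ) (a : ℝ) (v : L2 Ω) (j : ℕ+) :
    ⟪trunc lam φ a v, φ j⟫_ℝ = if lam j ≤ a then ⟪v, φ j⟫_ℝ else 0 := by
  have hs : Summable fun i => if lam i ≤ a then ⟪v, φ i⟫_ℝ • φ i else 0 := by
    have h1 := ((φ.hasSum_repr v).summable).indicator {i | lam i ≤ a}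
    refine h1.congr fun i => ?_
    simp only [indicator_apply, mem_ofPred_eq, φ.repr_apply_apply, real_inner_comm]
  have h2 := hs.hasSum.mapL (innerSL ℝ (φ j))
  rw [real_inner_comm, trunc]
  refine h2.unique ?_
  convert hasSum_single j ?_ using 1
  · split_ifs <;> simp [φ.orthonormal.1 j]
  · intro i hi
    split_ifs <;> simp [inner_basis, hi.symm]

end Hilbert

variable {d : ℕ} {Ω : Set (Eucl d)}

/-- The Fourier coefficients of a solution of the backward heat problem. -/
lemma IsHeatSolution.exp_mul_inner {T : ℝ} {f u : ℝ → L2 Ω} {g v : L2 Ω} {l : ℝ}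
    (hu : IsHeatSolution Ω T f g u) (hv : IsDirichletEigenfunction Ω l v)
    (hf : IntegrableOn (fun s => ⟪f s, v⟫_ℝ) (Ioo 0 T)) {t : ℝ} (ht : t ∈ Icc 0 T) :
    Real.exp (l * t) * ⟪u t, v⟫_ℝ =
      Real.exp (l * T) * ⟪g, v⟫_ℝ - ∫ s in t..T, Real.exp (l * s) * ⟪f s, v⟫_ℝ := by
  obtain ⟨V, hV, heig⟩ := hv
  obtain ⟨U, -, hUg, hweak⟩ := hu.weak
  have hcont : ContinuousOn (fun s => ⟪u s, v⟫_ℝ) (Icc t T) :=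
    (hu.continuousOn.mono (Icc_subset_Icc_left ht.1)).inner continuousOn_const
  rw [← hu.final]
  refine variation_of_constants ht.2 (hcont.intervalIntegrable_of_Icc ht.2)
    (intervalIntegrable_of_integrableOn_Ioo hf ht) fun τ hτ => ?_
  have hτ0 : τ ∈ Icc 0 T := ⟨ht.1.trans hτ.1, hτ.2⟩
  rw [← hweak v V hV τ hτ0]
  congr 1
  have hae := ae_restrict_Icc_of_ae_restrict_Ioo hτ0 hUg
  rw [intervalIntegral.integral_of_le hτ.2, intervalIntegral.integral_of_le hτ.2]
  refine integral_congr_ae (ae_mono (Measure.restrict_mono Ioc_subset_Icc_self le_rfl) ?_)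
  filter_upwards [hae] with s hs
  -- For almost every `s` the slice `u s` lies in `H¹₀`, so it is admissible as a test function in
  -- the eigenvalue equation.
  rw [real_inner_comm V (U s), heig _ _ hs, real_inner_comm]

lemma IsSource.ae_norm_sub_le (hΩ : MeasurableSet Ω) {T k : ℝ} {F : Eucl d → ℝ → ℝ → ℝ}
    (hF : ∀ x ∈ Ω, ∀ t ∈ Ioo 0 T, ∀ a b : ℝ, |F x t a - F x t b| ≤ k * |a - b|)
    {u w fu fw : ℝ → L2 Ω} (hu : IsSource Ω T F u fu) (hw : IsSource Ω T F w fw) :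
    ∀ᵐ s ∂(volume.restrict (Ioo 0 T)), ‖fw s - fu s‖ ≤ k * ‖w s - u s‖ := by
  filter_upwards [hu.ae_eq, hw.ae_eq, ae_restrict_mem measurableSet_Ioo] with s h1 h2 hs
  apply Lp.norm_le_mul_norm_of_ae_le_mul
  filter_upwards [h1, h2, ae_restrict_mem hΩ, Lp.coeFn_sub (fw s) (fu s),
    Lp.coeFn_sub (w s) (u s)] with x e1 e2 hx e3 e4
  rw [e3, e4, Pi.sub_apply, Pi.sub_apply, e1, e2]
  exact hF x hx s hs _ _

lemma IsSource.integrableOn_inner {T : ℝ} {F : Eucl d → ℝ → ℝ → ℝ} {u f : ℝ → L2 Ω}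
    (h : IsSource Ω T F u f) (v : L2 Ω) : IntegrableOn (fun s => ⟪f s, v⟫_ℝ) (Ioo 0 T) :=
  h.integrable.inner_const v

/-! ### Pathwise error estimate. -/

section Error

variable {lam : ℕ+ → ℝ} {φ : HilbertBasis ℕ+ ℝ (L2 Ω)} {T a : ℝ} {F : Eucl d → ℝ → ℝ → ℝ}
  {u w fu fw : ℝ → L2 Ω} {g G : L2 Ω}

/-- Modes above the cut-off vanish for solutions of the truncated problem. -/
lemma inner_truncated_eq_zero (hφ : IsDirichletEigenbasis Ω lam φ)
    (hw : IsHeatSolution Ω T (fun s => trunc lam φ a (fw s)) (trunc lam φ a G) w) {j : ℕ+}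
    (hj : a < lam j) {t : ℝ} (ht : t ∈ Icc 0 T) : ⟪w t, φ j⟫_ℝ = 0 := by
  have h := hw.exp_mul_inner (hφ.eigen j) (by simp [inner_trunc, hj.not_ge]) ht
  simpa [inner_trunc, hj.not_ge, Real.exp_ne_zero] using h

/-- Truncation is invisible below the cut-off, so the two Duhamel formulas subtract. Then `(X - Y)²
≤ 2 X² + 2 Y²`, Cauchy–Schwarz in time, and replacing `lam j` by `a` in the exponents make the bound
uniform in the mode. -/
lemma inner_sub_sq_le_of_le (hφ : IsDirichletEigenbasis Ω lam φ)
    (hfu : IsSource Ω T F u fu) (hu : IsHeatSolution Ω T fu g u) (hfw : IsSource Ω T F w fw)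
    (hw : IsHeatSolution Ω T (fun s => trunc lam φ a (fw s)) (trunc lam φ a G) w)
    {j : ℕ+} (hj : lam j ≤ a)
    (h2 : IntegrableOn (fun s => ⟪fw s - fu s, φ j⟫_ℝ ^ 2) (Ioo 0 T))
    {t : ℝ} (ht : t ∈ Icc 0 T) :
    ⟪w t - u t, φ j⟫_ℝ ^ 2 ≤ 2 * Real.exp (2 * a * (T - t)) * ⟪G - g, φ j⟫_ℝ ^ 2
      + 2 * T * ∫ s in t..T, Real.exp (2 * a * (s - t)) * ⟪fw s - fu s, φ j⟫_ℝ ^ 2 := by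
  have hwi : IntegrableOn (fun s => ⟪fw s, φ j⟫_ℝ) (Ioo 0 T) := hfw.integrableOn_inner _
  have hui : IntegrableOn (fun s => ⟪fu s, φ j⟫_ℝ) (Ioo 0 T) := hfu.integrableOn_inner _
  have e1 := hu.exp_mul_inner (hφ.eigen j) hui ht
  have e2 := hw.exp_mul_inner (hφ.eigen j) (by simpa [inner_trunc, hj] using hwi) ht
  simp only [inner_trunc, hj, if_true] at e2
  set l := lam j
  have hexp : ∀ b, ContinuousOn (fun s : ℝ => Real.exp (b * (s - t))) (uIcc t T) := fun b => by
    fun_prop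
  have hexp' : ContinuousOn (fun s : ℝ => Real.exp (l * s)) (uIcc t T) := by fun_prop
  have hwI := (intervalIntegrable_of_integrableOn_Ioo hwi ht).continuousOn_mul hexp'
  have huI := (intervalIntegrable_of_integrableOn_Ioo hui ht).continuousOn_mul hexp'
  have hhI : IntervalIntegrable (fun s => ⟪fw s - fu s, φ j⟫_ℝ) volume t T := by
    simp only [inner_sub_left]
    exact intervalIntegrable_of_integrableOn_Ioo (hwi.sub hui) ht
  have h2I := intervalIntegrable_of_integrableOn_Ioo h2 ht
  have e3 : ⟪w t - u t, φ j⟫_ℝ = Real.exp (l * (T - t)) * ⟪G - g, φ j⟫_ℝ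
      - ∫ s in t..T, Real.exp (l * (s - t)) * ⟪fw s - fu s, φ j⟫_ℝ := by
    have e4 : ∫ s in t..T, Real.exp (l * (s - t)) * ⟪fw s - fu s, φ j⟫_ℝ =
        Real.exp (-(l * t)) * ((∫ s in t..T, Real.exp (l * s) * ⟪fw s, φ j⟫_ℝ)
          - ∫ s in t..T, Real.exp (l * s) * ⟪fu s, φ j⟫_ℝ) := by
      rw [← intervalIntegral.integral_sub hwI huI, ← intervalIntegral.integral_const_mul]
      congr 1
      funext s
      rw [← mul_sub, ← mul_assoc, ← Real.exp_add, inner_sub_left]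
      congr 2
      ring
    have e5 : Real.exp (l * (T - t)) = Real.exp (-(l * t)) * Real.exp (l * T) := by
      rw [← Real.exp_add]; congr 1; ring
    have e6 : Real.exp (-(l * t)) * Real.exp (l * t) = 1 := by rw [← Real.exp_add]; simp
    rw [e4, e5, inner_sub_left, inner_sub_left]
    linear_combination (-(⟪w t, φ j⟫_ℝ - ⟪u t, φ j⟫_ℝ)) * e6 + Real.exp (-(l * t)) * (e2 - e1)
  set X := Real.exp (l * (T - t)) * ⟪G - g, φ j⟫_ℝ
  set Y := ∫ s in t..T, Real.exp (l * (s - t)) * ⟪fw s - fu s, φ j⟫_ℝ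
  have hsq : ∀ b s : ℝ, Real.exp (b * (s - t)) ^ 2 = Real.exp (2 * b * (s - t)) := fun b s => by
    rw [← Real.exp_nat_mul]; congr 1; push_cast; ring
  have hX : X ^ 2 ≤ Real.exp (2 * a * (T - t)) * ⟪G - g, φ j⟫_ℝ ^ 2 := by
    rw [mul_pow, hsq]
    have := sub_nonneg.2 ht.2
    gcongr
  have hint : ∀ b, IntervalIntegrable
      (fun s => Real.exp (2 * b * (s - t)) * ⟪fw s - fu s, φ j⟫_ℝ ^ 2) volume t T := fun b =>
    h2I.continuousOn_mul (hexp (2 * b))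
  have hY : Y ^ 2 ≤
      T * ∫ s in t..T, Real.exp (2 * a * (s - t)) * ⟪fw s - fu s, φ j⟫_ℝ ^ 2 := by
    have c1 := sq_intervalIntegral_le ht.2 (hhI.continuousOn_mul (hexp l))
      (by simpa only [mul_pow, hsq] using hint l)
    simp only [mul_pow, hsq] at c1
    have c2 : ∫ s in t..T, Real.exp (2 * l * (s - t)) * ⟪fw s - fu s, φ j⟫_ℝ ^ 2 ≤
        ∫ s in t..T, Real.exp (2 * a * (s - t)) * ⟪fw s - fu s, φ j⟫_ℝ ^ 2 := by
      apply intervalIntegral.integral_mono_on ht.2 (hint l) (hint a)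
      intro s hs
      have := sub_nonneg.2 hs.1
      gcongr
    have c3 : 0 ≤ ∫ s in t..T, Real.exp (2 * a * (s - t)) * ⟪fw s - fu s, φ j⟫_ℝ ^ 2 :=
      intervalIntegral.integral_nonneg ht.2 fun s _ => by positivity
    have c4 := sub_nonneg.2 ht.2
    calc Y ^ 2 ≤ _ := c1
      _ ≤ (T - t) * ∫ s in t..T, Real.exp (2 * a * (s - t)) * ⟪fw s - fu s, φ j⟫_ℝ ^ 2 := by
        gcongr
      _ ≤ _ := by
        gcongr
        linarith [ht.1]
  rw [e3]
  nlinarith [sq_nonneg (X + Y)]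

/-- Pathwise stability estimate for the truncated problem. -/
lemma norm_sub_sq_le (hΩ : MeasurableSet Ω) (hφ : IsDirichletEigenbasis Ω lam φ) {k r A : ℝ}
    (hT : 0 < T) (hr : 0 < r)
    (hF : ∀ x ∈ Ω, ∀ t ∈ Ioo 0 T, ∀ a b : ℝ, |F x t a - F x t b| ≤ k * |a - b|)
    (hu : IsSolution Ω T F g u)
    (huA : ∀ t ∈ Icc 0 T,
      ∑' j, ENNReal.ofReal (Real.exp (2 * (t + r) * lam j) * ⟪u t, φ j⟫_ℝ ^ 2)
        ≤ ENNReal.ofReal A) (hA : 0 ≤ A)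
    (hw : IsTruncatedSolution lam φ a T F G w) {t : ℝ} (ht : t ∈ Icc 0 T) :
    ‖w t - u t‖ ^ 2 ≤ Real.exp (-2 * t * a) * Real.exp (2 * k ^ 2 * T * (T - t)) *
      (2 * Real.exp (2 * T * a) * ‖G - g‖ ^ 2 + A * Real.exp (-2 * r * a)) := by
  obtain ⟨fu, hfu, hu⟩ := hu
  obtain ⟨fw, hfw, hw⟩ := hw
  have hdc : ContinuousOn (fun s => w s - u s) (Icc 0 T) := hw.continuousOn.sub hu.continuousOn
  have hlip := IsSource.ae_norm_sub_le hΩ hF hfu hfw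
  have hd2 : IntegrableOn (fun s => k ^ 2 * ‖w s - u s‖ ^ 2) (Ioo 0 T) :=
    ((continuousOn_const.mul (hdc.norm.pow 2)).integrableOn_Icc).mono_set Ioo_subset_Icc_self
  have hhi : IntegrableOn (fun s => fw s - fu s) (Ioo 0 T) := hfw.integrable.sub hfu.integrable
  have hlip2 : ∀ᵐ s ∂(volume.restrict (Ioo 0 T)),
      ‖fw s - fu s‖ ^ 2 ≤ k ^ 2 * ‖w s - u s‖ ^ 2 := by
    filter_upwards [hlip] with s hs
    rw [← mul_pow]
    gcongr
  -- The sources are only `L¹` in time, but the Lipschitz bound dominates their difference by a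
  -- function continuous on `[0,T]`.
  have hj2 : ∀ j, IntegrableOn (fun s => ⟪fw s - fu s, φ j⟫_ℝ ^ 2) (Ioo 0 T) := fun j => by
    refine Integrable.mono' hd2 ((hhi.inner_const (φ j)).aestronglyMeasurable.pow 2) ?_
    filter_upwards [hlip2] with s hs
    rw [Real.norm_of_nonneg (sq_nonneg _)]
    refine le_trans ?_ hs
    simpa using sum_inner_sq_le φ (fw s - fu s) {j}
  -- One bound for both frequency ranges, so that it can be summed without splitting: the last term
  -- is superfluous for low modes, the first two for high ones.
  have hmode : ∀ τ ∈ Icc 0 T, ∀ j, ⟪w τ - u τ, φ j⟫_ℝ ^ 2 ≤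
      2 * Real.exp (2 * a * (T - τ)) * ⟪G - g, φ j⟫_ℝ ^ 2
      + 2 * T * (∫ s in τ..T, Real.exp (2 * a * (s - τ)) * ⟪fw s - fu s, φ j⟫_ℝ ^ 2)
      + Real.exp (-2 * (τ + r) * a) *
        (Real.exp (2 * (τ + r) * lam j) * ⟪u τ, φ j⟫_ℝ ^ 2) := fun τ hτ j => by
    have hI : 0 ≤ ∫ s in τ..T, Real.exp (2 * a * (s - τ)) * ⟪fw s - fu s, φ j⟫_ℝ ^ 2 :=
      intervalIntegral.integral_nonneg hτ.2 fun s _ => by positivity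
    rcases le_or_gt (lam j) a with hj | hj
    · have := inner_sub_sq_le_of_le hφ hfu hu hfw hw hj (hj2 j) hτ
      have h0 : 0 ≤ Real.exp (-2 * (τ + r) * a) *
        (Real.exp (2 * (τ + r) * lam j) * ⟪u τ, φ j⟫_ℝ ^ 2) := by positivity
      linarith
    · have h0 := inner_truncated_eq_zero hφ hw hj hτ
      have h1 : 1 ≤ Real.exp (-2 * (τ + r) * a) * Real.exp (2 * (τ + r) * lam j) := by
        rw [← Real.exp_add]
        apply Real.one_le_exp
        have : 0 ≤ (τ + r) * (lam j - a) := mul_nonneg (by linarith [hτ.1]) (by linarith)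
        linarith
      have h2 : ⟪w τ - u τ, φ j⟫_ℝ ^ 2 = ⟪u τ, φ j⟫_ℝ ^ 2 := by
        rw [inner_sub_left, h0]; ring
      have h3 := le_mul_of_one_le_left (sq_nonneg ⟪u τ, φ j⟫_ℝ) h1
      rw [mul_assoc] at h3
      have h4 : 0 ≤ 2 * Real.exp (2 * a * (T - τ)) * ⟪G - g, φ j⟫_ℝ ^ 2
        + 2 * T * (∫ s in τ..T, Real.exp (2 * a * (s - τ)) * ⟪fw s - fu s, φ j⟫_ℝ ^ 2) := by
        positivity
      linarith
  have hnorm : ∀ τ ∈ Icc 0 T, ‖w τ - u τ‖ ^ 2 ≤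
      2 * Real.exp (2 * a * (T - τ)) * ‖G - g‖ ^ 2
      + 2 * T * (∫ s in τ..T, Real.exp (2 * a * (s - τ)) * (k ^ 2 * ‖w s - u s‖ ^ 2))
      + Real.exp (-2 * (τ + r) * a) * A := fun τ hτ => by
    -- Bounding finite partial sums means only a finite sum has to pass through the time integral.
    refine le_of_tendsto' (hasSum_inner_sq φ (w τ - u τ)) fun S => ?_
    refine (Finset.sum_le_sum fun j _ => hmode τ hτ j).trans ?_
    rw [Finset.sum_add_distrib, Finset.sum_add_distrib, ← Finset.mul_sum, ← Finset.mul_sum,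
      ← Finset.mul_sum]
    have hexp : ContinuousOn (fun s : ℝ => Real.exp (2 * a * (s - τ))) (uIcc τ T) := by fun_prop
    have hi : ∀ j, IntervalIntegrable
        (fun s => Real.exp (2 * a * (s - τ)) * ⟪fw s - fu s, φ j⟫_ℝ ^ 2) volume τ T := fun j =>
      (intervalIntegrable_of_integrableOn_Ioo (hj2 j) hτ).continuousOn_mul hexp
    have hI : ∑ j ∈ S, ∫ s in τ..T, Real.exp (2 * a * (s - τ)) * ⟪fw s - fu s, φ j⟫_ℝ ^ 2 ≤
        ∫ s in τ..T, Real.exp (2 * a * (s - τ)) * (k ^ 2 * ‖w s - u s‖ ^ 2) := by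
      rw [← intervalIntegral.integral_finsetSum fun j _ => hi j]
      refine intervalIntegral.integral_mono_ae_restrict hτ.2
        (by simpa only [Finset.sum_fn] using IntervalIntegrable.sum S fun j _ => hi j)
        ((intervalIntegrable_of_integrableOn_Ioo hd2 hτ).continuousOn_mul hexp) ?_
      filter_upwards [ae_restrict_Icc_of_ae_restrict_Ioo hτ hlip2] with s hs
      rw [← Finset.mul_sum]
      gcongr
      exact (sum_inner_sq_le φ _ S).trans hs
    have hAS : ∑ j ∈ S, Real.exp (2 * (τ + r) * lam j) * ⟪u τ, φ j⟫_ℝ ^ 2 ≤ A := by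
      rw [← ENNReal.ofReal_le_ofReal_iff hA, ENNReal.ofReal_sum_of_nonneg fun j _ => by positivity]
      exact (ENNReal.sum_le_tsum S).trans (huA τ hτ)
    gcongr
    exact sum_inner_sq_le φ _ S
  -- This weight removes `τ` from the kernel `exp (2 * a * (s - τ))` and makes both data terms
  -- constant, which is the form Grönwall needs.
  set Z : ℝ → ℝ := fun s => Real.exp (2 * a * s) * ‖w s - u s‖ ^ 2 with hZ
  have hZc : ContinuousOn Z (Icc 0 T) :=
    (by fun_prop : Continuous fun s : ℝ => Real.exp (2 * a * s)).continuousOn.mul (hdc.norm.pow 2)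
  have hgr := gronwall_backward (K := 2 * k ^ 2 * T)
    (C := 2 * Real.exp (2 * T * a) * ‖G - g‖ ^ 2 + A * Real.exp (-2 * r * a)) hZc (by positivity)
    (fun τ hτ => by
      have h1 := mul_le_mul_of_nonneg_left (hnorm τ hτ) (Real.exp_nonneg (2 * a * τ))
      refine h1.trans (le_of_eq ?_)
      have e1 : Real.exp (2 * T * a) = Real.exp (2 * a * τ) * Real.exp (2 * a * (T - τ)) := by
        rw [← Real.exp_add]; congr 1; ring
      have e2 : Real.exp (-2 * r * a) = Real.exp (2 * a * τ) * Real.exp (-2 * (τ + r) * a) := by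
        rw [← Real.exp_add]; congr 1; ring
      have e3 : k ^ 2 * ∫ s in τ..T, Z s = Real.exp (2 * a * τ) *
          ∫ s in τ..T, Real.exp (2 * a * (s - τ)) * (k ^ 2 * ‖w s - u s‖ ^ 2) := by
        rw [← intervalIntegral.integral_const_mul, ← intervalIntegral.integral_const_mul]
        congr 1
        funext s
        have : Real.exp (2 * a * s) = Real.exp (2 * a * τ) * Real.exp (2 * a * (s - τ)) := by
          rw [← Real.exp_add]; congr 1; ring
        rw [hZ]
        dsimp only
        rw [this]
        ring
      rw [e1, e2]
      linear_combination (-2 * T) * e3) ht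
  have e0 : Real.exp (-2 * t * a) * Real.exp (2 * a * t) = 1 := by
    rw [← Real.exp_add, Real.exp_eq_one_iff]; ring
  calc ‖w t - u t‖ ^ 2 = Real.exp (-2 * t * a) * Z t := by
        rw [hZ]; dsimp only; rw [← mul_assoc, e0, one_mul]
    _ ≤ _ := mul_le_mul_of_nonneg_left hgr (Real.exp_nonneg _)
    _ = _ := by ring

end Error

end BackwardHeat

namespace BackwardHeat

variable {d : ℕ} {Ω : Set (Eucl d)} {lam : ℕ+ → ℝ} {φ : HilbertBasis ℕ+ ℝ (L2 Ω)}
  {S : Type*} [MeasurableSpace S] {P : Measure S}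

/-! ### Noise statistics and the `H^p` norm. -/

lemma inner_observed (ξ : L2 Ω →L[ℝ] Lp ℝ 2 P) (g : L2 Ω) (δ : ℝ) (N : ℕ+) (ω : S) (j : ℕ+) :
    ⟪observed φ ξ g δ N ω, φ j⟫_ℝ = if j ≤ N then ⟪g, φ j⟫_ℝ + δ * ξ (φ j) ω else 0 := by
  simp [observed, sum_inner, inner_smul_left, inner_basis]

lemma IsGaussianWhiteNoise.lintegral_sq {ξ : L2 Ω →L[ℝ] Lp ℝ 2 P} (hξ : IsGaussianWhiteNoise P ξ)
    (v : L2 Ω) : ∫⁻ ω, ENNReal.ofReal (ξ v ω ^ 2) ∂P = ENNReal.ofReal (‖v‖ ^ 2) := by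
  have h := hξ.covariance v v
  rw [real_inner_self_eq_norm_sq] at h
  rw [← h, ← ofReal_integral_eq_lintegral_ofReal (Lp.memLp (ξ v)).integrable_sq
    (ae_of_all _ fun _ => sq_nonneg _)]
  simp only [sq]

/-- Mean square error of the observed final data: variance of the noise plus squared bias. -/
lemma lintegral_norm_observed_sub_sq_le {ξ : L2 Ω →L[ℝ] Lp ℝ 2 P}
    (hξ : IsGaussianWhiteNoise P ξ) [IsProbabilityMeasure P]
    (hmono : Monotone lam) (hpos : ∀ j, 0 < lam j) {γ : ℝ} (hγ : 0 ≤ γ) {g : L2 Ω}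
    (hg : hpNormSq lam φ (2 * γ) g < ∞) (δ : ℝ) (N : ℕ+) :
    ∫⁻ ω, ENNReal.ofReal (‖observed φ ξ g δ N ω - g‖ ^ 2) ∂P ≤
      ENNReal.ofReal (δ ^ 2 * (N : ℝ) +
        1 / lam N ^ (2 * γ) * (hpNormSq lam φ (2 * γ) g).toReal) := by
  have hN : 0 < lam N ^ (2 * γ) := Real.rpow_pos_of_pos (hpos N) _
  have hpt : ∀ ω, ENNReal.ofReal (‖observed φ ξ g δ N ω - g‖ ^ 2) ≤
      (∑ j ∈ Finset.Icc 1 N, ENNReal.ofReal (δ ^ 2) * ENNReal.ofReal (ξ (φ j) ω ^ 2)) +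
        ENNReal.ofReal (1 / lam N ^ (2 * γ)) * hpNormSq lam φ (2 * γ) g := fun ω => by
    -- Mode by mode, the error is `δ ξ_j` for `j ≤ N` and `-g_j` beyond, where monotonicity of `lam`
    -- gives `(lam j / lam N) ^ (2 * γ) ≥ 1`.
    rw [← tsum_ofReal_inner_sq φ, hpNormSq, ← ENNReal.tsum_mul_left, sum_eq_tsum_indicator,
      ← ENNReal.tsum_add]
    refine ENNReal.tsum_le_tsum fun j => ?_
    rw [inner_sub_left, inner_observed]
    by_cases hj : j ≤ N
    · have : j ∈ ((Finset.Icc 1 N : Finset ℕ+) : Set ℕ+) := by simp [hj]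
      rw [indicator_of_mem this, if_pos hj, ← ENNReal.ofReal_mul (sq_nonneg δ)]
      refine le_add_right (le_of_eq ?_)
      congr 1
      ring
    · have : j ∉ ((Finset.Icc 1 N : Finset ℕ+) : Set ℕ+) := by simp [hj]
      rw [indicator_of_notMem this, if_neg hj, zero_add, ← ENNReal.ofReal_mul (by positivity)]
      apply ENNReal.ofReal_le_ofReal
      have h1 : lam N ^ (2 * γ) ≤ lam j ^ (2 * γ) :=
        Real.rpow_le_rpow (hpos N).le (hmono (not_le.1 hj).le) (by positivity)
      have h2 : 1 ≤ 1 / lam N ^ (2 * γ) * lam j ^ (2 * γ) := by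
        rw [one_div_mul_eq_div, one_le_div hN]; exact h1
      have h3 := le_mul_of_one_le_left (sq_nonneg ⟪g, φ j⟫_ℝ) h2
      rw [zero_sub, neg_sq]
      linarith
  refine (lintegral_mono hpt).trans (le_of_eq ?_)
  have hm : ∀ j, AEMeasurable (fun ω => ENNReal.ofReal (ξ (φ j) ω ^ 2)) P := fun j =>
    ((Lp.aestronglyMeasurable (ξ (φ j))).aemeasurable.pow_const 2).ennreal_ofReal
  rw [lintegral_add_right _ measurable_const, lintegral_const, measure_univ, mul_one,
    lintegral_finsetSum' _ fun j _ => (hm j).const_mul _]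
  have hj : ∀ j, ∫⁻ ω, ENNReal.ofReal (δ ^ 2) * ENNReal.ofReal (ξ (φ j) ω ^ 2) ∂P =
      ENNReal.ofReal (δ ^ 2) := fun j => by
    rw [lintegral_const_mul'' _ (hm j), hξ.lintegral_sq, φ.orthonormal.1 j]
    simp
  simp only [hj, Finset.sum_const, PNat.card_Icc, nsmul_eq_mul]
  rw [ENNReal.ofReal_add (by positivity) (by positivity), mul_comm (δ ^ 2),
    ENNReal.ofReal_mul (Nat.cast_nonneg _), ENNReal.ofReal_mul (p := 1 / lam N ^ (2 * γ))
      (by positivity), ENNReal.ofReal_toReal hg.ne, ENNReal.ofReal_natCast]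
  simp

/-- `x ↦ x^p e^{-cx}` is decreasing beyond `p / c`. -/
lemma rpow_le_rpow_mul_exp {a l p c : ℝ} (ha : 0 < a) (hal : a ≤ l) (hp : 0 ≤ p)
    (hpc : p ≤ c * a) : l ^ p ≤ a ^ p * Real.exp (-c * a) * Real.exp (c * l) := by
  have hl : 0 < l := ha.trans_le hal
  have h1 : Real.log (l / a) ≤ l / a - 1 := Real.log_le_sub_one_of_pos (by positivity)
  rw [Real.log_div hl.ne' ha.ne'] at h1
  rw [Real.rpow_def_of_pos hl, Real.rpow_def_of_pos ha, ← Real.exp_add, ← Real.exp_add]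
  apply Real.exp_le_exp.2
  have h2 : 0 ≤ l / a - 1 := by
    rw [sub_nonneg, one_le_div ha]; exact hal
  have h3 : p * (Real.log l - Real.log a) ≤ c * a * (l / a - 1) :=
    (mul_le_mul_of_nonneg_left h1 hp).trans (mul_le_mul_of_nonneg_right hpc h2)
  have h4 : c * a * (l / a - 1) = c * l - c * a := by field_simp
  linarith

/-- The `H^p` norm of the error, split at the cut-off frequency. -/
lemma hpNormSq_sub_le (hpos : ∀ j, 0 < lam j) {a c p A : ℝ} (ha : 0 < a) (hp : 0 ≤ p)
    (hpc : p ≤ c * a) {v u : L2 Ω}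
    (hv : ∀ j, a < lam j → ⟪v, φ j⟫_ℝ = 0)
    (hu : ∑' j, ENNReal.ofReal (Real.exp (c * lam j) * ⟪u, φ j⟫_ℝ ^ 2) ≤ ENNReal.ofReal A) :
    hpNormSq lam φ p (v - u) ≤ ENNReal.ofReal (a ^ p) * ENNReal.ofReal (‖v - u‖ ^ 2)
      + ENNReal.ofReal (a ^ p * Real.exp (-c * a)) * ENNReal.ofReal A := by
  have hap : 0 ≤ a ^ p := Real.rpow_nonneg ha.le _
  refine le_trans ?_ (add_le_add_right (mul_le_mul_right hu _) _)
  rw [← tsum_ofReal_inner_sq φ, ← ENNReal.tsum_mul_left, ← ENNReal.tsum_mul_left,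
    ← ENNReal.tsum_add, hpNormSq]
  refine ENNReal.tsum_le_tsum fun j => ?_
  rcases le_or_gt (lam j) a with hj | hj
  · refine le_add_right ?_
    rw [← ENNReal.ofReal_mul hap]
    apply ENNReal.ofReal_le_ofReal
    have := (hpos j).le
    gcongr
  · refine le_add_left ?_
    rw [← ENNReal.ofReal_mul (by positivity)]
    apply ENNReal.ofReal_le_ofReal
    rw [inner_sub_left, hv j hj, zero_sub, neg_sq, ← mul_assoc]
    gcongr
    exact rpow_le_rpow_mul_exp ha hj.le hp hpc

end BackwardHeat

/-! ### The mean square estimate. -/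

theorem mainTheorem2 {d : ℕ} (hd : 1 ≤ d) (Ω : Set (Eucl d)) (hΩo : IsOpen Ω)
    (hΩb : Bornology.IsBounded Ω) (hΩc : IsConnected Ω)
    (lam : ℕ+ → ℝ) (φ : HilbertBasis ℕ+ ℝ (L2 Ω)) (hφ : IsDirichletEigenbasis Ω lam φ)
    {S : Type*} [MeasurableSpace S] (P : Measure S) [IsProbabilityMeasure P]
    (ξ : L2 Ω →L[ℝ] Lp ℝ 2 P) (hξ : IsGaussianWhiteNoise P ξ)
    (T k r A γ p : ℝ) (hT : 0 < T) (hk : 0 ≤ k) (hr : 0 < r) (hγ : 0 ≤ γ) (hp : 0 ≤ p)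
    (F : Eucl d → ℝ → ℝ → ℝ)
    (hF : ∀ x ∈ Ω, ∀ t ∈ Ioo 0 T, ∀ a b : ℝ, |F x t a - F x t b| ≤ k * |a - b|)
    (g : L2 Ω) (hg : hpNormSq lam φ (2 * γ) g < ∞)
    (u : ℝ → L2 Ω) (hu : IsSolution Ω T F g u)
    (huA : ∀ t ∈ Icc 0 T,
      ∑' j, ENNReal.ofReal (Real.exp (2 * (t + r) * lam j) * ⟪u t, φ j⟫_ℝ ^ 2)
        < ENNReal.ofReal A)
    (N : ℝ → ℕ+) (α : ℝ → ℝ)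
    (hα : Tendsto α (𝓝[>] 0) atTop)
    (hαN : Tendsto (fun δ => Real.exp (k * T * α δ) / lam (N δ) ^ γ) (𝓝[>] 0) (𝓝 0))
    (hαδ : Tendsto (fun δ => Real.exp (k * T * α δ) * Real.sqrt (N δ : ℝ) * δ)
      (𝓝[>] 0) (𝓝 0))
    (uδ : ℝ → S → ℝ → L2 Ω)
    (huδm : ∀ δ > 0, ∀ t ∈ Icc 0 T, AEStronglyMeasurable (fun ω => uδ δ ω t) P)
    (huδ : ∀ δ > 0, ∀ᵐ ω ∂P,
      IsTruncatedSolution lam φ (α δ) T F (observed φ ξ g δ (N δ) ω) (uδ δ ω)) :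
    ∀ᶠ δ in 𝓝[>] 0, ∀ t ∈ Icc 0 T,
      ∫⁻ ω, hpNormSq lam φ p (uδ δ ω t - u t) ∂P ≤
        ENNReal.ofReal
          (2 * Real.exp (2 * k ^ 2 * T * (T - t)) * Real.exp (-2 * t * α δ) * |α δ| ^ p *
              (2 * δ ^ 2 * (N δ : ℝ) * Real.exp (2 * T * α δ)
                + 2 * (Real.exp (2 * T * α δ) / lam (N δ) ^ (2 * γ)) *
                    (hpNormSq lam φ (2 * γ) g).toReal
                + A * Real.exp (-2 * r * α δ))
            + A * |α δ| ^ p * Real.exp (-2 * (t + r) * α δ)) := by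
  have hpos : ∀ j, 0 < lam j := fun j =>
    eigenvalue_pos hd hΩb (hφ.eigen j) (φ.orthonormal.ne_zero j)
  have hA : 0 < A := ENNReal.ofReal_pos.1 (pos_of_gt (huA 0 (left_mem_Icc.2 hT.le)))
  -- The threshold `p / (2 * r)` gives `p ≤ 2 * (t + r) * a` for all `t ≥ 0` at once, so smallness
  -- of `δ` is uniform in time.
  filter_upwards [self_mem_nhdsWithin, hα.eventually_ge_atTop (p / (2 * r)),
    hα.eventually_gt_atTop 0] with δ hδ hα1 hα0 t ht
  have hδ : 0 < δ := hδ
  set a := α δ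
  rw [abs_of_pos hα0]
  have hNpos : 0 < lam (N δ) ^ (2 * γ) := Real.rpow_pos_of_pos (hpos _) _
  have hap : 0 ≤ a ^ p := Real.rpow_nonneg hα0.le _
  have hpc : p ≤ 2 * (t + r) * a := by
    rw [div_le_iff₀ (by positivity)] at hα1
    have := mul_nonneg ht.1 hα0.le
    linarith
  set E := Real.exp (-2 * t * a) * Real.exp (2 * k ^ 2 * T * (T - t)) with hE
  have hE0 : 0 ≤ E := by positivity
  set M := (hpNormSq lam φ (2 * γ) g).toReal
  have hpath : ∀ᵐ ω ∂P, hpNormSq lam φ p (uδ δ ω t - u t) ≤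
      ENNReal.ofReal (a ^ p * E * (2 * Real.exp (2 * T * a))) *
        ENNReal.ofReal (‖observed φ ξ g δ (N δ) ω - g‖ ^ 2)
      + ENNReal.ofReal (a ^ p * E * (A * Real.exp (-2 * r * a))
        + a ^ p * Real.exp (-2 * (t + r) * a) * A) := by
    filter_upwards [huδ δ hδ] with ω hω
    have h1 := norm_sub_sq_le hΩo.measurableSet hφ hT hr hF hu (fun t ht => (huA t ht).le) hA.le
      hω ht
    obtain ⟨fw, -, hw⟩ := hω
    have h2 := hpNormSq_sub_le hpos hα0 hp hpc
      (fun j hj => inner_truncated_eq_zero hφ hw hj ht) (huA t ht).le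
    refine h2.trans ?_
    rw [← ENNReal.ofReal_mul hap, ← ENNReal.ofReal_mul (by positivity),
      ← ENNReal.ofReal_mul (by positivity), ← ENNReal.ofReal_add (by positivity) (by positivity),
      ← ENNReal.ofReal_add (by positivity) (by positivity)]
    apply ENNReal.ofReal_le_ofReal
    have h3 := mul_le_mul_of_nonneg_left h1 hap
    have h4 : -(2 * (t + r)) * a = -2 * (t + r) * a := by ring
    rw [h4]
    linarith
  refine (lintegral_mono_ae hpath).trans ?_
  -- Only the final data error remains random; the other term is constant and has total mass one.
  rw [lintegral_add_right _ measurable_const, lintegral_const, measure_univ, mul_one,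
    lintegral_const_mul' _ _ ENNReal.ofReal_ne_top]
  refine (add_le_add_left (mul_le_mul_right
    (lintegral_norm_observed_sub_sq_le hξ hφ.monotone hpos hγ hg δ (N δ)) _) _).trans ?_
  rw [← ENNReal.ofReal_mul (by positivity), ← ENNReal.ofReal_add (by positivity) (by positivity)]
  apply ENNReal.ofReal_le_ofReal
  -- The argument gives the bracket with prefactor one; these nonnegative quantities absorb the
  -- stated factor `2`.
  have hX : 0 ≤ a ^ p * E * (2 * δ ^ 2 * (N δ : ℝ) * Real.exp (2 * T * a)
      + 2 * (Real.exp (2 * T * a) / lam (N δ) ^ (2 * γ)) * M) := by positivity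
  have hY : 0 ≤ a ^ p * E * (A * Real.exp (-2 * r * a)) := by positivity
  have e1 : a ^ p * E * (2 * Real.exp (2 * T * a)) *
      (δ ^ 2 * (N δ : ℝ) + 1 / lam (N δ) ^ (2 * γ) * M) =
      a ^ p * E * (2 * δ ^ 2 * (N δ : ℝ) * Real.exp (2 * T * a)
      + 2 * (Real.exp (2 * T * a) / lam (N δ) ^ (2 * γ)) * M) := by ring
  rw [e1]
  linarith
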